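/- **Setting.** Fix $0<q<1$. For $x=(x^1,x^2,x^3)\in\mathbb Z^3$ let $l(x)=x^1+x^2+x^3$. Let $\Sigma_0^\infty=\{\dots,-e_2-e_3,\,-e_3,\,0,\,e_1,\,e_1+e_2,\,e_1+e_2+e_3,\,e_1+e_2+e_3+e_1,\dots\}$ be the infinite stick (one vertex on each plane $l=c$, $c\in\mathbb Z$), and for even $L\ge 0$ let $\Sigma_0=\{x\in\Sigma_0^\infty: -L/2\le l(x)\le L/2\}$. A *cylindrical volume* with base $\Gamma$ (a finite subset of the plane $\{l(x)=0\}$) and length $L$ is $\Lambda=\{x+y: x\in\Gamma,\ y\in\Sigma_0\}$. The *linear size* of the base is $|\Gamma|^{1/2}$. We write $\Lambda_k\nearrow\mathbb Z^3$ if $\Lambda_k\subseteq\Lambda_{k+1}$ for all $k$ and $\bigcup_k\Lambda_k=\mathbb Z^3$. For finite $\Lambda\subset\mathbb Z^3$, the basis vectors $|\alpha\rangle=\bigotimes_{x\in\Lambda}|\alpha(x)\rangle$ of $(\mathbb C^2)^{\otimes\Lambda}$ are labelled by $\alpha\in\{0,1\}^\Lambda$, with $|0\rangle=|{\uparrow}\rangle$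 and $|1\rangle=|{\downarrow}\rangle$. Let $\mathsf N|\alpha\rangle=\big(\sum_x\alpha(x)\big)|\alpha\rangle$, and let $J^{(3)}=\sum_x S^{(3)}_x$ with $S^{(3)}=\mathrm{diag}(\tfrac12,-\tfrac12)$. The canonical (interface) ground states of the spin-$\tfrac12$ XXZ model are $$\langle X\rangle_{\Lambda,n}=\frac{\langle\psi_0(\Lambda,n)|X|\psi_0(\Lambda,n)\rangle}{\|\psi_0(\Lambda,n)\|^2},\qquad \psi_0(\Lambda,n)=\sum_{\alpha:\ \sum_x\alpha(x)=n}\ \bigotimes_{x\in\Lambda}q^{l(x)\alpha(x)}|\alpha(x)\rangle ,$$ and the grand canonical states with chemical potential $\mu\in\mathbb R$ are $$\langle X\rangle^{GC}_{\Lambda,\mu}=\frac{\langle\psi^{GC}(\Lambda,\mu)|X|\psi^{GC}(\Lambda,\mu)\rangle}{\|\psi^{GC}(\Lambda,\mu)\|^2},\qquad \psi^{GC}(\Lambda,\mu)=\bigotimes_{x\in\Lambda}\big(|{\uparrow}\rangle+q^{l(x)-\mu}|{\downarrow}\rangle\big).$$ Let $\langle\,\cdot\,\rangle^{GC}_{\mathbb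 Z^3,\mu}$ be the infinite product state given by the unit vectors $\big(|{\uparrow}\rangle+q^{l(x)-\mu}|{\downarrow}\rangle\big)/\sqrt{1+q^{2(l(x)-\mu)}}$, $x\in\mathbb Z^3$. A local observable is an operator $X$ on $(\mathbb C^2)^{\otimes\Lambda_0}$ for some finite $\Lambda_0\subset\mathbb Z^3$; it is identified with $X\otimes 1$ on every finite $\Lambda\supseteq\Lambda_0$. It is gauge invariant if it commutes with $J^{(3)}$. **Corollary (Existence of the thermodynamic limit).** (i) Let $(\Lambda_k,n_k)_k$ be a sequence of cylindrical volumes $\Lambda_k$ (base $\Gamma_k$, length $L_k$) and integers $n_k\geq 0$ with $\Lambda_k\nearrow\mathbb Z^3$ and $L_k=O(|\Gamma_k|^{1/2})$. Let $\mu_k\in\mathbb R$ satisfy $\langle\mathsf N\rangle^{GC}_{\Lambda_k,\mu_k}=n_k$ for every $k$. If $\mu_k\to\mu\in\mathbb R$, then for every local observable $X$ commuting with $J^{(3)}$, $$\langle X\rangle_{\Lambda_k,n_k}\longrightarrow\langle X\rangle^{GC}_{\mathbb Z^3,\mu}\qquad(k\to\infty).$$ (ii) Conversely, for every $\mu\in\mathbb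 R$ there are sequences $(\Lambda_k,n_k)_k$ and $(\mu_k)_k$ as in (i), i.e. $\Lambda_k\nearrow\mathbb Z^3$ cylindrical with $L_k=O(|\Gamma_k|^{1/2})$, $\langle\mathsf N\rangle^{GC}_{\Lambda_k,\mu_k}=n_k$ and $\mu_k\to\mu$, such that $\langle X\rangle_{\Lambda_k,n_k}\to\langle X\rangle^{GC}_{\mathbb Z^3,\mu}$ for every local observable $X$ commuting with $J^{(3)}$. -/

import Mathlib

open Filter Topology Asymptotics
open scoped Matrix

noncomputable section

namespace XXZ

/-! ### Geometry -/

/-- Sites of the cubic lattice. -/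
abbrev Site : Type := Fin 3 → ℤ

/-- `l(x) = x¹ + x² + x³`. -/
def level (x : Site) : ℤ := x 0 + x 1 + x 2

/-- The vertex at level `l` of the infinite stick
`…, -e₂-e₃, -e₃, 0, e₁, e₁+e₂, e₁+e₂+e₃, e₁+e₂+e₃+e₁, …`
(integer division by `3` rounds down). -/
def stickSite (l : ℤ) : Site := ![(l + 2) / 3, (l + 1) / 3, l / 3]

lemma stickSite_zero : stickSite 0 = 0 := by
  ext i; fin_cases i <;> simp [stickSite]

lemma level_stickSite (l : ℤ) : level (stickSite l) = l := by
  simp only [level, stickSite, Matrix.cons_val_zero, Matrix.cons_val_one, Matrix.cons_val]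
  omega

/-- Going up the stick, the steps are `e₁, e₂, e₃, e₁, e₂, e₃, …`, starting with `e₁` at `0`. -/
lemma stickSite_step (m : ℤ) :
    stickSite (3 * m + 1) = stickSite (3 * m) + Pi.single 0 1 ∧
    stickSite (3 * m + 2) = stickSite (3 * m + 1) + Pi.single 1 1 ∧
    stickSite (3 * m + 3) = stickSite (3 * m + 2) + Pi.single 2 1 := by
  refine ⟨?_, ?_, ?_⟩ <;> ext i <;> fin_cases i <;> simp [stickSite] <;> omega

/-- The finite stick with `L + 1` vertices (`L` even): the levels `-L/2, …, L/2`. -/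
def finiteStick (L : ℕ) : Finset Site :=
  (Finset.Icc (-((L / 2 : ℕ) : ℤ)) ((L / 2 : ℕ) : ℤ)).image stickSite

/-- A finite cylindrical volume along the 111 axis: a base in the plane `l(x) = 0` and an even
length `L`. -/
structure CylindricalVolume where
  base : Finset Site
  level_base : ∀ x ∈ base, level x = 0
  length : ℕ
  even_length : Even length

/-- The sites `x + y`, with `x` in the base and `y` in the finite stick. -/
def CylindricalVolume.sites (V : CylindricalVolume) : Finset Site :=
  Finset.image₂ (fun x y => x + y) V.base (finiteStick V.length)

/-- The linear size `A^{1/2}` of the base, where `A` is its number of vertices. -/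
def CylindricalVolume.linearSize (V : CylindricalVolume) : ℝ := √(V.base.card : ℝ)

/-- `Λ_k ↗ ℤ³`, the length growing no faster than the linear size of the base. -/
structure IsThermodynamicSequence (V : ℕ → CylindricalVolume) : Prop where
  monotone : Monotone fun k => (V k).sites
  exhausts : ∀ x : Site, ∃ k, x ∈ (V k).sites
  growth : (fun k => ((V k).length : ℝ)) =O[atTop] fun k => (V k).linearSize

/-! ### Spin systems on finite volumes -/

/-- Configurations on `Λ`: `0` is an up spin (empty site), `1` is a down spin (particle). They
label the standard basis of `(ℂ²)^{⊗Λ}`, whose vectors are the functions `Config Λ → ℂ`. -/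
abbrev Config (Λ : Finset Site) : Type := Λ → Fin 2

/-- Observables on `Λ`, as matrices in the standard basis. -/
abbrev Observable (Λ : Finset Site) : Type := Matrix (Config Λ) (Config Λ) ℂ

/-- The number of particles (down spins) of a configuration. -/
def particleNumber {Λ : Finset Site} (α : Config Λ) : ℕ := ∑ x, (α x : ℕ)

/-- The number operator `N`. -/
def numberOperator (Λ : Finset Site) : Observable Λ :=
  Matrix.diagonal fun α => (particleNumber α : ℂ)

/-- The one-site matrix `M` acting at the site `x` of `Λ`. -/
def siteOp {Λ : Finset Site} (x : Λ) (M : Matrix (Fin 2) (Fin 2) ℂ) : Observable Λ :=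
  Matrix.of fun α β => if ∀ y, y ≠ x → α y = β y then M (α x) (β x) else 0

def S1 : Matrix (Fin 2) (Fin 2) ℂ := !![0, 1 / 2; 1 / 2, 0]
def S2 : Matrix (Fin 2) (Fin 2) ℂ := !![0, -Complex.I / 2; Complex.I / 2, 0]
def S3 : Matrix (Fin 2) (Fin 2) ℂ := !![1 / 2, 0; 0, -1 / 2]

/-- The third component of the total spin, `J⁽³⁾ = ∑ₓ Sₓ⁽³⁾`. -/
def totalSpin3 (Λ : Finset Site) : Observable Λ := ∑ x, siteOp x S3

/-- The embedding `X ↦ X ⊗ 1` of the observables on `Λ₀` into those on `Λ ⊇ Λ₀`. -/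
def extend {Λ₀ Λ : Finset Site} (h : Λ₀ ⊆ Λ) (X : Observable Λ₀) : Observable Λ :=
  Matrix.of fun α β =>
    if ∀ y : Λ, y.1 ∉ Λ₀ → α y = β y then
      X (fun x => α ⟨x.1, h x.2⟩) (fun x => β ⟨x.1, h x.2⟩)
    else 0

/-- `⟨ψ|X|ψ⟩ / ⟨ψ|ψ⟩`. -/
def expectation {Λ : Finset Site} (ψ : Config Λ → ℂ) (X : Observable Λ) : ℂ :=
  (star ψ ⬝ᵥ X *ᵥ ψ) / (star ψ ⬝ᵥ ψ)

/-! ### Interface states -/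

/-- The canonical ground state vector with `n` particles,
`∑_{α : N(α) = n} ⨂ₓ q^{l(x) α(x)} |α(x)⟩`. -/
def canonicalVector (q : ℝ) (Λ : Finset Site) (n : ℕ) : Config Λ → ℂ := fun α =>
  if particleNumber α = n then ((∏ x : Λ, q ^ (level x * ((α x : ℕ) : ℤ)) : ℝ) : ℂ) else 0

/-- The grand canonical vector `⨂ₓ (|↑⟩ + q^{l(x) - μ} |↓⟩)`. -/
def grandCanonicalVector (q : ℝ) (Λ : Finset Site) (μ : ℝ) : Config Λ → ℂ := fun α =>
  ∏ x : Λ, (![1, ((q ^ ((level x : ℝ) - μ) : ℝ) : ℂ)] : Fin 2 → ℂ) (α x)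

/-- The canonical state `⟨X⟩_{Λ,n}`. -/
def canonicalState (q : ℝ) (Λ : Finset Site) (n : ℕ) (X : Observable Λ) : ℂ :=
  expectation (canonicalVector q Λ n) X

/-- The finite-volume grand canonical state `⟨X⟩^{GC}_{Λ,μ}`. -/
def grandCanonicalState (q : ℝ) (Λ : Finset Site) (μ : ℝ) (X : Observable Λ) : ℂ :=
  expectation (grandCanonicalVector q Λ μ) X

/-- The unit vector `(|↑⟩ + q^{l(x) - μ} |↓⟩) / √(1 + q^{2(l(x) - μ)})` at the site `x`. -/
def siteVector (q μ : ℝ) (x : Site) : Fin 2 → ℂ :=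
  ![((1 / √(1 + q ^ (2 * ((level x : ℝ) - μ))) : ℝ) : ℂ),
    ((q ^ ((level x : ℝ) - μ) / √(1 + q ^ (2 * ((level x : ℝ) - μ))) : ℝ) : ℂ)]

/-- The infinite-volume grand canonical state `⟨X⟩^{GC}_{ℤ³,μ}`: the product over all sites of the
pure states given by the unit vectors `siteVector q μ x`, evaluated at a local observable `X`.
All sites outside the finite set `Λ₀` on which `X` acts contribute a factor `1`, see
`infiniteGrandCanonicalState_extend`. -/
def infiniteGrandCanonicalState (q μ : ℝ) {Λ₀ : Finset Site} (X : Observable Λ₀) : ℂ :=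
  star (fun α : Config Λ₀ => ∏ x : Λ₀, siteVector q μ x (α x)) ⬝ᵥ
    X *ᵥ (fun α : Config Λ₀ => ∏ x : Λ₀, siteVector q μ x (α x))

/-- The states `ω k` on the volumes `Λ k` converge, as `k → ∞`, to the infinite-volume grand
canonical state with parameter `μ`, on all local observables that commute with `J⁽³⁾`. An
observable on a finite set `Λ₀` is an observable on `Λ k` as soon as `Λ₀ ⊆ Λ k`. -/
def ConvergesToGrandCanonical (q : ℝ) (Λ : ℕ → Finset Site) (ω : ∀ k, Observable (Λ k) → ℂ)
    (μ : ℝ) : Prop :=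
  ∀ (Λ₀ : Finset Site) (X : Observable Λ₀), Commute X (totalSpin3 Λ₀) →
    ∀ ε > 0, ∃ K, ∀ k ≥ K, ∃ h : Λ₀ ⊆ Λ k,
      ‖ω k (extend h X) - infiniteGrandCanonicalState q μ X‖ < ε

/-! ### The XXZ Hamiltonian -/

/-- The oriented nearest-neighbour bonds `(x₀, x₁)` in `Λ`, with `l(x₁) = l(x₀) + 1`. -/
def bonds (Λ : Finset Site) : Finset (Λ × Λ) :=
  Finset.univ.filter fun b =>
    ∑ i, (b.1.1 i - b.2.1 i) ^ 2 = 1 ∧ level b.2 = level b.1 + 1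

/-- The anisotropy `Δ = (q + q⁻¹) / 2`. -/
def anisotropy (q : ℝ) : ℝ := (q + q⁻¹) / 2

/-- The bond Hamiltonian, the orthogonal projection on `q |↓↑⟩ - |↑↓⟩`. -/
def bondTerm (q : ℝ) {Λ : Finset Site} (x₀ x₁ : Λ) : Observable Λ :=
  -(((anisotropy q)⁻¹ : ℝ) : ℂ) • (siteOp x₀ S1 * siteOp x₁ S1 + siteOp x₀ S2 * siteOp x₁ S2)
    - siteOp x₀ S3 * siteOp x₁ S3 + (1 / 4 : ℂ) • (1 : Observable Λ)
    + ((√(1 - ((anisotropy q)⁻¹) ^ 2) / 2 : ℝ) : ℂ) • (siteOp x₀ S3 - siteOp x₁ S3)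

/-- The spin-1/2 ferromagnetic XXZ Hamiltonian with the boundary terms that select the 111
interface. -/
def hamiltonian (q : ℝ) (Λ : Finset Site) : Observable Λ :=
  ∑ b ∈ bonds Λ, bondTerm q b.1 b.2

lemma siteOp_mulVec {Λ : Finset Site} (x : Λ) (M : Matrix (Fin 2) (Fin 2) ℂ)
    (φ : Config Λ → ℂ) (α : Config Λ) :
    (siteOp x M *ᵥ φ) α = ∑ s, M (α x) s * φ (Function.update α x s) := by
  classical
  simp only [Matrix.mulVec, dotProduct, siteOp, Matrix.of_apply, ite_mul, zero_mul]
  rw [← Finset.sum_filter]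
  symm
  refine Finset.sum_bij (fun s _ => Function.update α x s) ?_ ?_ ?_ ?_
  · intro s _
    simp only [Finset.mem_filter, Finset.mem_univ, true_and]
    intro y hy
    simp [hy]
  · intro s _ t _ h
    simpa using congrFun h x
  · intro β hβ
    simp only [Finset.mem_filter, Finset.mem_univ, true_and] at hβ
    refine ⟨β x, Finset.mem_univ _, ?_⟩
    ext1 y
    by_cases hy : y = x
    · subst hy; simp
    · simp [hy, hβ y hy]
  · intro s _
    simp

lemma siteOp_isHermitian {Λ : Finset Site} (x : Λ) {M : Matrix (Fin 2) (Fin 2) ℂ}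
    (hM : M.IsHermitian) : (siteOp x M).IsHermitian := by
  ext α β
  simp only [siteOp, Matrix.conjTranspose_apply, Matrix.of_apply]
  have : (∀ y, y ≠ x → β y = α y) ↔ (∀ y, y ≠ x → α y = β y) := by
    constructor <;> intro h y hy <;> exact (h y hy).symm
  simp only [this]
  split_ifs
  · exact hM.apply _ _
  · simp

lemma siteOp_commute {Λ : Finset Site} {x y : Λ} (hxy : x ≠ y)
    (M N : Matrix (Fin 2) (Fin 2) ℂ) : siteOp x M * siteOp y N = siteOp y N * siteOp x M := by
  refine Matrix.ext_of_mulVec_single fun β => ?_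
  ext α
  simp only [← Matrix.mulVec_mulVec, siteOp_mulVec, Fin.sum_univ_two,
    Function.update_of_ne hxy, Function.update_of_ne hxy.symm, Function.update_comm hxy]
  ring

lemma bondTerm_mulVec {q : ℝ} (hq0 : 0 < q) (hq1 : q < 1) {Λ : Finset Site} {x y : Λ}
    (hxy : x ≠ y) (φ : Config Λ → ℂ) (α : Config Λ) :
    (bondTerm q x y *ᵥ φ) α = if α x = α y then 0 else
      (if α x = 1 then (q : ℂ) ^ 2 / (1 + (q : ℂ) ^ 2) else 1 / (1 + (q : ℂ) ^ 2)) * φ α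
        - (q : ℂ) / (1 + (q : ℂ) ^ 2) *
          φ (Function.update (Function.update α x (α y)) y (α x)) := by
  have hΔ : (anisotropy q)⁻¹ = 2 * q / (1 + q ^ 2) := by
    unfold anisotropy; field_simp; ring
  have hs : √(1 - ((anisotropy q)⁻¹) ^ 2) = (1 - q ^ 2) / (1 + q ^ 2) := by
    rw [hΔ, show 1 - (2 * q / (1 + q ^ 2)) ^ 2 = ((1 - q ^ 2) / (1 + q ^ 2)) ^ 2 by
      field_simp; ring]
    exact Real.sqrt_sq (div_nonneg (by nlinarith) (by positivity))
  have hne : (1 + (q : ℂ) ^ 2) ≠ 0 := by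
    have : (1 + q ^ 2 : ℝ) ≠ 0 := by positivity
    exact_mod_cast this
  have hux : ∀ s : Fin 2, s = α x → Function.update α x s = α := by rintro s rfl; simp
  have huy : ∀ s : Fin 2, s = α y → Function.update α y s = α := by rintro s rfl; simp
  unfold bondTerm
  rw [hs, hΔ]
  simp only [Matrix.add_mulVec, Matrix.sub_mulVec, Matrix.smul_mulVec, Pi.add_apply,
    Pi.sub_apply, Pi.smul_apply, smul_eq_mul, ← Matrix.mulVec_mulVec, siteOp_mulVec,
    Fin.sum_univ_two, Function.update_of_ne hxy.symm,
    Matrix.one_mulVec]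
  rcases Fin.exists_fin_two.mp ⟨α x, rfl⟩ with hx | hx <;>
  rcases Fin.exists_fin_two.mp ⟨α y, rfl⟩ with hy | hy <;>
  simp only [hx, hy, S1, S2, S3] at hux huy ⊢ <;>
  simp [hux, huy] <;> field_simp <;> ring_nf <;> simp <;> ring

lemma bonds_ne {Λ : Finset Site} {b : Λ × Λ} (hb : b ∈ bonds Λ) : b.1 ≠ b.2 := by
  intro h
  simp [bonds, h] at hb

lemma S1_isHermitian : S1.IsHermitian := by
  ext i j; fin_cases i <;> fin_cases j <;> simp [S1]

lemma S2_isHermitian : S2.IsHermitian := by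
  ext i j; fin_cases i <;> fin_cases j <;> simp [S2]

lemma S3_isHermitian : S3.IsHermitian := by
  ext i j; fin_cases i <;> fin_cases j <;> simp [S3]

lemma bondTerm_isHermitian (q : ℝ) {Λ : Finset Site} {x y : Λ} (hxy : x ≠ y) :
    (bondTerm q x y).IsHermitian := by
  have hmul : ∀ {M : Matrix (Fin 2) (Fin 2) ℂ}, M.IsHermitian →
      (siteOp x M * siteOp y M).conjTranspose = siteOp x M * siteOp y M := by
    intro M hM
    rw [Matrix.conjTranspose_mul, (siteOp_isHermitian x hM).eq, (siteOp_isHermitian y hM).eq,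
      siteOp_commute hxy]
  unfold bondTerm Matrix.IsHermitian
  simp only [Matrix.conjTranspose_add, Matrix.conjTranspose_sub, Matrix.conjTranspose_smul,
    hmul S1_isHermitian, hmul S2_isHermitian, hmul S3_isHermitian, Matrix.conjTranspose_one,
    (siteOp_isHermitian x S3_isHermitian).eq, (siteOp_isHermitian y S3_isHermitian).eq]
  simp

/-- The bond Hamiltonian is a projection. -/
lemma bondTerm_sq {q : ℝ} (hq0 : 0 < q) (hq1 : q < 1) {Λ : Finset Site} {x y : Λ}
    (hxy : x ≠ y) : bondTerm q x y * bondTerm q x y = bondTerm q x y := by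
  have hne : (1 + (q : ℂ) ^ 2) ≠ 0 := by
    have : (1 + q ^ 2 : ℝ) ≠ 0 := by positivity
    exact_mod_cast this
  refine Matrix.ext_of_mulVec_single fun β => ?_
  ext α
  generalize (Pi.single β 1 : Config Λ → ℂ) = φ
  have hback : Function.update (Function.update (Function.update (Function.update α x (α y))
      y (α x)) x (α x)) y (α y) = α := by
    ext1 z
    by_cases hzy : z = y
    · subst hzy; simp
    · by_cases hzx : z = x
      · subst hzx; simp [hzy]
      · simp [hzy, hzx]
  simp only [← Matrix.mulVec_mulVec, bondTerm_mulVec hq0 hq1 hxy, Function.update_self,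
    Function.update_of_ne hxy, hback]
  rcases Fin.exists_fin_two.mp ⟨α x, rfl⟩ with hx | hx <;>
  rcases Fin.exists_fin_two.mp ⟨α y, rfl⟩ with hy | hy <;>
  simp only [hx, hy] <;> simp <;> field_simp <;> ring

lemma sum_update {Λ : Finset Site} (f : Λ → ℤ) (α : Config Λ) (x : Λ) (s : Fin 2) :
    ∑ z, f z * ((Function.update α x s z : ℕ) : ℤ) =
      ∑ z, f z * ((α z : ℕ) : ℤ) + f x * (((s : ℕ) : ℤ) - ((α x : ℕ) : ℤ)) := by
  classical
  rw [← Finset.add_sum_erase _ _ (Finset.mem_univ x),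
    ← Finset.add_sum_erase _ (fun z => f z * ((α z : ℕ) : ℤ)) (Finset.mem_univ x)]
  rw [Finset.sum_congr rfl (g := fun z => f z * ((α z : ℕ) : ℤ))]
  · simp; ring
  · intro z hz
    simp [Finset.ne_of_mem_erase hz]

lemma canonicalVector_eq {q : ℝ} (hq0 : 0 < q) (Λ : Finset Site) (n : ℕ) (α : Config Λ) :
    canonicalVector q Λ n α = if ∑ z, 1 * ((α z : ℕ) : ℤ) = (n : ℤ) then
      (q : ℂ) ^ (∑ z : Λ, level z * ((α z : ℕ) : ℤ)) else 0 := by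
  classical
  have hp : ∀ s : Finset Λ, ∏ x ∈ s, q ^ (level x * ((α x : ℕ) : ℤ)) =
      q ^ (∑ z ∈ s, level z * ((α z : ℕ) : ℤ)) := by
    intro s
    induction s using Finset.induction_on with
    | empty => simp
    | insert a s ha ih => rw [Finset.prod_insert ha, Finset.sum_insert ha, ih, zpow_add₀ hq0.ne']
  have hn : (∑ z, 1 * ((α z : ℕ) : ℤ) = (n : ℤ)) ↔ particleNumber α = n := by
    simp only [one_mul, particleNumber]; exact_mod_cast Iff.rfl
  simp only [canonicalVector, hn, hp]
  push_cast
  rfl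

section

open scoped ComplexOrder

/-- `canonicalVector q Λ n` is a ground state: `H_Λ` is nonnegative and annihilates it. -/
theorem canonicalVector_isGroundState {q : ℝ} (hq0 : 0 < q) (hq1 : q < 1) (Λ : Finset Site)
    (n : ℕ) : (hamiltonian q Λ).PosSemidef ∧ hamiltonian q Λ *ᵥ canonicalVector q Λ n = 0 := by
  constructor
  · refine Matrix.posSemidef_sum _ fun b hb => ?_
    have h := Matrix.posSemidef_conjTranspose_mul_self (bondTerm q b.1 b.2)
    rwa [(bondTerm_isHermitian q (bonds_ne hb)).eq, bondTerm_sq hq0 hq1 (bonds_ne hb)] at h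
  · unfold hamiltonian
    rw [Matrix.sum_mulVec]
    refine Finset.sum_eq_zero fun b hb => ?_
    have hxy := bonds_ne hb
    have hl : level b.2.1 = level b.1.1 + 1 := by
      simp only [bonds, Finset.mem_filter] at hb; exact hb.2.2
    have hqc : (q : ℂ) ≠ 0 := by exact_mod_cast hq0.ne'
    ext α
    rw [bondTerm_mulVec hq0 hq1 hxy]
    simp only [canonicalVector_eq hq0, sum_update, Function.update_of_ne hxy.symm, hl,
      Pi.zero_apply]
    rcases Fin.exists_fin_two.mp ⟨α b.1, rfl⟩ with hx | hx <;>
    rcases Fin.exists_fin_two.mp ⟨α b.2, rfl⟩ with hy | hy <;>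
    simp only [hx, hy] <;> simp
    · split_ifs
      · rw [add_assoc, show level b.1.1 + (-1 + -level b.1.1) = -1 by ring, zpow_add₀ hqc]
        simp; field_simp; ring
      · simp
    · split_ifs
      · rw [zpow_add₀ hqc]
        simp; field_simp; ring
      · simp

end

/-- The value of the infinite-volume grand canonical state at a local observable does not depend
on the finite set of sites on which the observable is considered. -/
theorem infiniteGrandCanonicalState_extend {q : ℝ} (hq0 : 0 < q) (μ : ℝ) {Λ₀ Λ : Finset Site}
    (h : Λ₀ ⊆ Λ) (X : Observable Λ₀) :
    infiniteGrandCanonicalState q μ (extend h X) = infiniteGrandCanonicalState q μ X := by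
  classical
  have hunit : ∀ x, star (siteVector q μ x 0) * siteVector q μ x 0 +
      star (siteVector q μ x 1) * siteVector q μ x 1 = 1 := by
    intro x
    have hpos : 0 < 1 + q ^ (2 * ((level x : ℝ) - μ)) := by positivity
    have hsq : q ^ (2 * ((level x : ℝ) - μ)) = (q ^ ((level x : ℝ) - μ)) ^ 2 := by
      rw [mul_comm, Real.rpow_mul hq0.le]; norm_cast
    simp only [siteVector, Matrix.cons_val_zero, Matrix.cons_val_one, Complex.star_def,
      Complex.conj_ofReal]
    norm_cast
    rw [div_mul_div_comm, div_mul_div_comm, Real.mul_self_sqrt hpos.le, ← add_div, one_mul,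
      div_eq_one_iff_eq hpos.ne', hsq]
    ring
  let R := {y : Λ // y.1 ∉ Λ₀}
  let e : Config Λ₀ × (R → Fin 2) ≃ Config Λ :=
    { toFun := fun p y => if hy : y.1 ∈ Λ₀ then p.1 ⟨y.1, hy⟩ else p.2 ⟨y, hy⟩
      invFun := fun α => (fun x => α ⟨x.1, h x.2⟩, fun y => α y.1)
      left_inv := by
        rintro ⟨a, b⟩
        refine Prod.ext ?_ ?_
        · funext x; simp
        · funext y; simp [y.2]
      right_inv := by
        intro α; funext y
        by_cases hy : y.1 ∈ Λ₀ <;> simp [hy] }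
  have he1 : ∀ p (x : Λ₀), e p ⟨x.1, h x.2⟩ = p.1 x := by intro p x; simp [e]
  have he2 : ∀ p (y : R), e p y.1 = p.2 y := by intro p y; simp [e, y.2]
  have hprod : ∀ p, ∏ x : Λ, siteVector q μ x (e p x) =
      (∏ x : Λ₀, siteVector q μ x (p.1 x)) * ∏ y : R, siteVector q μ y.1 (p.2 y) := by
    intro p
    rw [← Fintype.prod_subtype_mul_prod_subtype (fun y : Λ => y.1 ∈ Λ₀)]
    congr 1
    · let f : Λ₀ ≃ {y : Λ // y.1 ∈ Λ₀} :=
        { toFun := fun x => ⟨⟨x.1, h x.2⟩, x.2⟩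
          invFun := fun y => ⟨y.1.1, y.2⟩
          left_inv := fun _ => rfl
          right_inv := fun _ => rfl }
      rw [← Equiv.prod_comp f]
      exact Finset.prod_congr rfl fun x _ => by rw [← he1 p x]; rfl
    · exact Finset.prod_congr rfl fun y _ => by rw [← he2 p y]
  have hagree : ∀ p p', (∀ y : Λ, y.1 ∉ Λ₀ → e p y = e p' y) ↔ p.2 = p'.2 := by
    intro p p'
    constructor
    · intro H; funext y; rw [← he2 p y, ← he2 p' y]; exact H y.1 y.2
    · intro H y hy
      have := congrFun H ⟨y, hy⟩
      rwa [← he2 p ⟨y, hy⟩, ← he2 p' ⟨y, hy⟩] at this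
  have hnorm : ∑ b : R → Fin 2, star (∏ y : R, siteVector q μ y.1 (b y)) *
      ∏ y : R, siteVector q μ y.1 (b y) = 1 := by
    simp only [star_prod, ← Finset.prod_mul_distrib]
    rw [← Fintype.prod_sum (fun (y : R) s =>
      star (siteVector q μ y.1 s) * siteVector q μ y.1 s)]
    simp [Fin.sum_univ_two]
    refine Finset.prod_eq_one fun y _ => ?_
    simpa using hunit y.1
  have hX : ∀ p p', extend h X (e p) (e p') = if p.2 = p'.2 then X p.1 p'.1 else 0 := by
    intro p p'
    simp only [extend, Matrix.of_apply, hagree, he1]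
  unfold infiniteGrandCanonicalState
  simp only [dotProduct, Matrix.mulVec, Pi.star_apply]
  rw [← Equiv.sum_comp e]
  simp_rw [← Equiv.sum_comp e, hX, hprod]
  simp only [Fintype.sum_prod_type, ite_mul, zero_mul]
  refine Finset.sum_congr rfl fun a _ => ?_
  calc _ = ∑ b : R → Fin 2, (star (∏ x : Λ₀, siteVector q μ x (a x)) *
        ∑ a', X a a' * ∏ x : Λ₀, siteVector q μ x (a' x)) *
        (star (∏ y : R, siteVector q μ y.1 (b y)) * ∏ y : R, siteVector q μ y.1 (b y)) := by
        refine Finset.sum_congr rfl fun b _ => ?_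
        have hb : ∀ a' : Config Λ₀, (∑ b' : R → Fin 2, if b = b' then
            X a a' * ((∏ x : Λ₀, siteVector q μ x (a' x)) * ∏ y : R, siteVector q μ y.1 (b' y))
            else 0) = (X a a' * ∏ x : Λ₀, siteVector q μ x (a' x)) *
              ∏ y : R, siteVector q μ y.1 (b y) := by
          intro a'
          rw [Finset.sum_eq_single b]
          · simp [mul_assoc]
          · intro b' _ hbb
            exact if_neg hbb.symm
          · simp
        rw [Finset.sum_congr rfl fun a' _ => hb a', ← Finset.sum_mul, star_mul']
        ring
    _ = _ := by rw [← Finset.mul_sum, hnorm, mul_one]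

end XXZ

end

/-! ### Weighted subset sums -/

namespace SubsetSum

variable {ι : Type*}

/-- The sum, over the subsets of `s` with `m` elements, of the products of the weights: the `m`-th
elementary symmetric function of the weights, extended by zero to all integers `m`. -/
noncomputable def weightSum (v : ι → ℝ) (s : Finset ι) (m : ℤ) : ℝ :=
  ∑ t ∈ s.powerset, if (t.card : ℤ) = m then ∏ x ∈ t, v x else 0

/-- The probability of the presence of `x` if the odds are `v x`. -/
noncomputable def occupation (v : ι → ℝ) (x : ι) : ℝ := v x / (1 + v x)

/-- The mean number of elements of a random subset of `s` with odds `v`. -/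
noncomputable def mean (v : ι → ℝ) (s : Finset ι) : ℝ := ∑ x ∈ s, occupation v x

/-- The variance of the number of elements of a random subset of `s` with odds `v`. -/
noncomputable def variance (v : ι → ℝ) (s : Finset ι) : ℝ := ∑ x ∈ s, occupation v x * (1 - occupation v x)

lemma weightSum_empty (v : ι → ℝ) (m : ℤ) : weightSum v ∅ m = if m = 0 then 1 else 0 := by
  simp [weightSum, eq_comm]

variable {v : ι → ℝ}

lemma weightSum_nonneg (hv : ∀ x, 0 < v x) (s : Finset ι) (m : ℤ) : 0 ≤ weightSum v s m := by
  refine Finset.sum_nonneg fun t _ => ?_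
  split_ifs
  · exact Finset.prod_nonneg fun x _ => (hv x).le
  · rfl

lemma weightSum_pos (hv : ∀ x, 0 < v x) {s : Finset ι} {m : ℤ} (h0 : 0 ≤ m) (h1 : m ≤ s.card) :
    0 < weightSum v s m := by
  lift m to ℕ using h0
  obtain ⟨t, hts, htm⟩ := Finset.exists_subset_card_eq (s := s) (n := m) (by exact_mod_cast h1)
  refine Finset.sum_pos' (fun t _ => ?_) ⟨t, Finset.mem_powerset.mpr hts, ?_⟩
  · split_ifs
    · exact Finset.prod_nonneg fun x _ => (hv x).le
    · rfl
  · rw [if_pos (by exact_mod_cast htm)]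
    exact Finset.prod_pos fun x _ => hv x

lemma occupation_pos (hv : ∀ x, 0 < v x) (x : ι) : 0 < occupation v x := by
  have := hv x
  unfold occupation; positivity

lemma one_sub_occupation (hv : ∀ x, 0 < v x) (x : ι) : 1 - occupation v x = 1 / (1 + v x) := by
  have := hv x
  unfold occupation; field_simp; ring

lemma occupation_lt_one (hv : ∀ x, 0 < v x) (x : ι) : occupation v x < 1 := by
  have := hv x
  have h := one_sub_occupation hv x
  have : 0 < 1 / (1 + v x) := by positivity
  linarith

lemma variance_le_mean (hv : ∀ x, 0 < v x) (s : Finset ι) : variance v s ≤ mean v s :=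
  Finset.sum_le_sum fun x _ => by nlinarith [occupation_pos hv x]

lemma variance_le_card_sub_mean (v : ι → ℝ) (s : Finset ι) :
    variance v s ≤ s.card - mean v s := by
  rw [variance, mean, Finset.card_eq_sum_ones, Nat.cast_sum, ← Finset.sum_sub_distrib]
  refine Finset.sum_le_sum fun x _ => ?_
  push_cast
  nlinarith [sq_nonneg (1 - occupation v x)]

variable [DecidableEq ι]

lemma weightSum_insert (v : ι → ℝ) {s : Finset ι} {x : ι} (hx : x ∉ s) (m : ℤ) :
    weightSum v (insert x s) m = weightSum v s m + v x * weightSum v s (m - 1) := by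
  unfold weightSum
  rw [Finset.sum_powerset_insert hx, Finset.mul_sum]
  congr 1
  refine Finset.sum_congr rfl fun t ht => ?_
  have hxt : x ∉ t := fun h => hx (Finset.mem_powerset.mp ht h)
  rw [Finset.card_insert_of_notMem hxt, Finset.prod_insert hxt]
  have : ((t.card + 1 : ℕ) : ℤ) = m ↔ (t.card : ℤ) = m - 1 := by omega
  simp only [this]
  split_ifs <;> simp

lemma weightSum_erase (v : ι → ℝ) {s : Finset ι} {x : ι} (hx : x ∈ s) (m : ℤ) :
    weightSum v s m = weightSum v (s.erase x) m + v x * weightSum v (s.erase x) (m - 1) := by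
  rw [← weightSum_insert v (Finset.notMem_erase x s), Finset.insert_erase hx]

/-- The elementary symmetric functions of positive weights are log-concave. -/
lemma weightSum_mul_le (hv : ∀ x, 0 < v x) (s : Finset ι) {i j : ℤ} (hij : i ≤ j) :
    weightSum v s (i - 1) * weightSum v s (j + 1) ≤ weightSum v s i * weightSum v s j := by
  induction s using Finset.induction_on generalizing i j with
  | empty =>
    simp only [weightSum_empty]
    split_ifs <;> simp <;> omega
  | insert x s hx ih =>
    simp only [weightSum_insert v hx]
    have hx0 := hv x
    have h1 := ih hij
    have h2 := ih (i := i - 1) (j := j - 1) (by omega)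
    have h3 : weightSum v s (i - 1 - 1) * weightSum v s (j + 1) ≤
        weightSum v s i * weightSum v s (j - 1) := by
      rcases hij.eq_or_lt with rfl | h
      · have := ih (i := i - 1) (j := i) (by omega)
        linarith [mul_comm (weightSum v s i) (weightSum v s (i - 1))]
      · have h4 := ih (i := i) (j := j - 1) (by omega)
        have h5 := ih (i := i - 1) (j := j) (by omega)
        rw [sub_add_cancel] at h4
        exact h5.trans h4
    rw [sub_add_cancel] at h2
    rw [add_sub_cancel_right]
    have e2 := mul_le_mul_of_nonneg_left h2 (sq_nonneg (v x))
    have e3 := mul_le_mul_of_nonneg_left h3 hx0.le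
    linear_combination h1 + e2 + e3

lemma weightSum_mul_erase_le (hv : ∀ x, 0 < v x) {s : Finset ι} {x : ι} (hx : x ∈ s) (m : ℤ) :
    weightSum v (s.erase x) m * weightSum v s (m - 1) ≤
      weightSum v s m * weightSum v (s.erase x) (m - 1) := by
  rw [weightSum_erase v hx, weightSum_erase v hx m]
  have h := weightSum_mul_le hv (s.erase x) (i := m - 1) (j := m - 1) le_rfl
  rw [sub_add_cancel] at h
  have := mul_le_mul_of_nonneg_left h (hv x).le
  linear_combination this

lemma weightSum_succ_mul_erase_le (hv : ∀ x, 0 < v x) {s : Finset ι} {x : ι} (hx : x ∈ s) (m : ℤ) :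
    weightSum v (s.erase x) (m - 1) * weightSum v s (m + 1) ≤
      weightSum v s m * weightSum v (s.erase x) m := by
  rw [weightSum_erase v hx, weightSum_erase v hx m, add_sub_cancel_right]
  have h := weightSum_mul_le hv (s.erase x) (i := m) (j := m) le_rfl
  linear_combination h

lemma sum_mul_weightSum_erase (v : ι → ℝ) (s : Finset ι) (m : ℤ) :
    ∑ x ∈ s, v x * weightSum v (s.erase x) (m - 1) = m * weightSum v s m := by
  induction s using Finset.induction_on generalizing m with
  | empty =>
    simp only [Finset.sum_empty, weightSum_empty]
    split_ifs with h <;> simp [h]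
  | insert y s hy ih =>
    rw [Finset.sum_insert hy, Finset.erase_insert hy, weightSum_insert v hy]
    have : ∀ x ∈ s, v x * weightSum v ((insert y s).erase x) (m - 1) =
        v x * weightSum v (s.erase x) (m - 1) +
          v y * (v x * weightSum v (s.erase x) (m - 1 - 1)) := by
      intro x hx
      have hxy : y ≠ x := fun h => hy (h ▸ hx)
      rw [Finset.erase_insert_of_ne hxy,
        weightSum_insert v (fun h => hy (Finset.mem_of_mem_erase h))]
      ring
    rw [Finset.sum_congr rfl this, Finset.sum_add_distrib, ← Finset.mul_sum, ih m, ih (m - 1)]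
    push_cast
    ring

/-- The discrete Stein identity for sums of independent Bernoulli variables. -/
lemma sub_mean_mul_weightSum (hv : ∀ x, 0 < v x) (s : Finset ι) (m : ℤ) :
    (m - mean v s) * weightSum v s m = ∑ x ∈ s, occupation v x *
      (weightSum v (s.erase x) (m - 1) - weightSum v (s.erase x) m) := by
  rw [sub_mul, ← sum_mul_weightSum_erase, mean, Finset.sum_mul, ← Finset.sum_sub_distrib]
  refine Finset.sum_congr rfl fun x hx => ?_
  have := hv x
  rw [weightSum_erase v hx m, occupation]
  field_simp
  ring

lemma variance_mul_pred_sub_le (hv : ∀ x, 0 < v x) {s : Finset ι} {m : ℤ}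
    (hm : 0 < weightSum v s m) :
    variance v s * (weightSum v s (m - 1) - weightSum v s m) ≤
      |m - mean v s| * weightSum v s (m - 1) := by
  have hvar : 0 ≤ variance v s := Finset.sum_nonneg fun x _ =>
    mul_nonneg (occupation_pos hv x).le (sub_nonneg.mpr (occupation_lt_one hv x).le)
  rcases le_total (weightSum v s (m - 1)) (weightSum v s m) with h | h
  · exact (mul_nonpos_of_nonneg_of_nonpos hvar (sub_nonpos.mpr h)).trans
      (mul_nonneg (abs_nonneg _) (weightSum_nonneg hv _ _))
  have hpos : 0 < weightSum v s (m - 1) := hm.trans_le h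
  have key : variance v s * (weightSum v s (m - 1) - weightSum v s m) * weightSum v s m ≤
      (m - mean v s) * weightSum v s m * weightSum v s (m - 1) := by
    rw [sub_mean_mul_weightSum hv, variance, Finset.sum_mul, Finset.sum_mul, Finset.sum_mul]
    refine Finset.sum_le_sum fun x hx => ?_
    have hp := occupation_pos hv x
    have hvx := hv x
    have hb := weightSum_mul_erase_le hv hx m
    have hle : weightSum v s m ≤ (1 + v x) * weightSum v (s.erase x) (m - 1) := by
      refine le_of_mul_le_mul_right ?_ hpos
      have e := weightSum_erase v hx m
      have := mul_le_mul_of_nonneg_right h (weightSum_nonneg hv (s.erase x) (m - 1))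
      linear_combination hb + this + weightSum v s (m - 1) * e
    rw [one_sub_occupation hv]
    have h2 : 1 / (1 + v x) * weightSum v s m ≤ weightSum v (s.erase x) (m - 1) := by
      rw [one_div, inv_mul_le_iff₀ (by positivity)]; exact hle
    have h3 := mul_le_mul_of_nonneg_left h2 (sub_nonneg.mpr h)
    have h4 : (weightSum v s (m - 1) - weightSum v s m) * (1 / (1 + v x) * weightSum v s m) ≤
        (weightSum v (s.erase x) (m - 1) - weightSum v (s.erase x) m) * weightSum v s (m - 1) := by
      linear_combination h3 + hb
    have h5 := mul_le_mul_of_nonneg_left h4 hp.le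
    linear_combination h5
  refine le_of_mul_le_mul_right (key.trans ?_) hm
  have := mul_le_mul_of_nonneg_right (le_abs_self ((m : ℝ) - mean v s)) (mul_pos hm hpos).le
  linear_combination this

lemma variance_mul_succ_sub_le (hv : ∀ x, 0 < v x) {s : Finset ι} {m : ℤ}
    (hm : 0 < weightSum v s m) :
    variance v s * (weightSum v s (m + 1) - weightSum v s m) ≤
      |m - mean v s| * weightSum v s (m + 1) := by
  have hvar : 0 ≤ variance v s := Finset.sum_nonneg fun x _ =>
    mul_nonneg (occupation_pos hv x).le (sub_nonneg.mpr (occupation_lt_one hv x).le)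
  rcases le_total (weightSum v s (m + 1)) (weightSum v s m) with h | h
  · exact (mul_nonpos_of_nonneg_of_nonpos hvar (sub_nonpos.mpr h)).trans
      (mul_nonneg (abs_nonneg _) (weightSum_nonneg hv _ _))
  have hpos : 0 < weightSum v s (m + 1) := hm.trans_le h
  have key : variance v s * (weightSum v s (m + 1) - weightSum v s m) * weightSum v s m ≤
      -((m - mean v s) * weightSum v s m) * weightSum v s (m + 1) := by
    rw [sub_mean_mul_weightSum hv, variance, Finset.sum_mul, Finset.sum_mul, ← Finset.sum_neg_distrib,
      Finset.sum_mul]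
    refine Finset.sum_le_sum fun x hx => ?_
    have hp := occupation_pos hv x
    have hvx := hv x
    have hb := weightSum_succ_mul_erase_le hv hx m
    have hle : weightSum v s m ≤ (1 + v x) * weightSum v (s.erase x) m := by
      refine le_of_mul_le_mul_right ?_ hpos
      have e := weightSum_erase v hx m
      have h6 := mul_le_mul_of_nonneg_left (mul_le_mul_of_nonneg_right h
        (weightSum_nonneg hv (s.erase x) m)) hvx.le
      have h7 := mul_le_mul_of_nonneg_left hb hvx.le
      linear_combination h6 + h7 + weightSum v s (m + 1) * e
    rw [one_sub_occupation hv]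
    have h2 : 1 / (1 + v x) * weightSum v s m ≤ weightSum v (s.erase x) m := by
      rw [one_div, inv_mul_le_iff₀ (by positivity)]; exact hle
    have h3 := mul_le_mul_of_nonneg_left h2 (sub_nonneg.mpr h)
    have h4 : (weightSum v s (m + 1) - weightSum v s m) * (1 / (1 + v x) * weightSum v s m) ≤
        (weightSum v (s.erase x) m - weightSum v (s.erase x) (m - 1)) * weightSum v s (m + 1) := by
      linear_combination h3 + hb
    have h5 := mul_le_mul_of_nonneg_left h4 hp.le
    linear_combination h5
  refine le_of_mul_le_mul_right (key.trans ?_) hm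
  have := mul_le_mul_of_nonneg_right (neg_le_abs ((m : ℝ) - mean v s)) (mul_pos hm hpos).le
  linear_combination this

lemma abs_sub_mean_shift {C l : ℝ} {n : ℤ} (h : |n - l| ≤ C) (j : ℕ) :
    |((n - j : ℤ) : ℝ) - l| ≤ C + j := by
  rw [abs_le] at h ⊢
  push_cast
  have : (0 : ℝ) ≤ j := by positivity
  constructor <;> linarith

/-- If the variance tends to infinity, the distribution becomes flat near the mean. -/
theorem tendsto_weightSum_div {v : ℕ → ι → ℝ} (hv : ∀ k x, 0 < v k x) {s : ℕ → Finset ι}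
    {n : ℕ → ℤ} {C : ℝ} (hn : ∀ᶠ k in atTop, |n k - mean (v k) (s k)| ≤ C)
    (hvar : Tendsto (fun k => variance (v k) (s k)) atTop atTop) (j : ℕ) :
    Tendsto (fun k => weightSum (v k) (s k) (n k - j) / weightSum (v k) (s k) (n k))
      atTop (𝓝 1) := by
  have hpos : ∀ j : ℕ, ∀ᶠ k in atTop, 0 < weightSum (v k) (s k) (n k - j) := by
    intro j
    filter_upwards [hn, hvar.eventually_ge_atTop (C + j)] with k hk hk'
    have h := abs_le.mp (abs_sub_mean_shift hk j)
    have h1 := variance_le_mean (hv k) (s k)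
    have h2 := variance_le_card_sub_mean (v k) (s k)
    refine weightSum_pos (hv k) ?_ ?_
    · have : (0 : ℝ) ≤ ((n k - j : ℤ) : ℝ) := by linarith
      exact_mod_cast this
    · have : ((n k - j : ℤ) : ℝ) ≤ (s k).card := by linarith
      exact_mod_cast this
  have hstep : ∀ j : ℕ, Tendsto (fun k => weightSum (v k) (s k) (n k - (j + 1 : ℕ)) /
      weightSum (v k) (s k) (n k - j)) atTop (𝓝 1) := by
    intro j
    have hε : Tendsto (fun k => 1 - (C + (j + 1 : ℕ)) / variance (v k) (s k)) atTop (𝓝 1) := by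
      simpa using tendsto_const_nhds.sub (hvar.const_div_atTop (C + (j + 1 : ℕ)))
    have hinv := hε.inv₀ one_ne_zero
    rw [inv_one] at hinv
    refine tendsto_of_tendsto_of_tendsto_of_le_of_le' hε hinv ?_ ?_
    · filter_upwards [hn, hpos j, hpos (j + 1), hvar.eventually_gt_atTop 0] with k hk h0 h1 hV
      have h := variance_mul_succ_sub_le (hv k) h1
      rw [show n k - (j + 1 : ℕ) + 1 = n k - j by push_cast; ring] at h
      have h2 := h.trans (mul_le_mul_of_nonneg_right (abs_sub_mean_shift hk (j + 1)) h0.le)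
      rw [le_div_iff₀ h0]
      refine le_of_mul_le_mul_left ?_ hV
      have h3 : variance (v k) (s k) * ((C + (j + 1 : ℕ)) / variance (v k) (s k)) =
        C + (j + 1 : ℕ) := by field_simp
      linear_combination h2 - weightSum (v k) (s k) (n k - j) * h3
    · filter_upwards [hn, hpos j, hpos (j + 1), hvar.eventually_gt_atTop 0,
        hε.eventually_const_lt zero_lt_one] with k hk h0 h1 hV hlt
      have h := variance_mul_pred_sub_le (hv k) h0
      rw [show n k - j - 1 = n k - (j + 1 : ℕ) by push_cast; ring] at h
      have h4 : |((n k - j : ℤ) : ℝ) - mean (v k) (s k)| ≤ C + (j + 1 : ℕ) :=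
        (abs_sub_mean_shift hk j).trans (by push_cast; linarith)
      have h2 := h.trans (mul_le_mul_of_nonneg_right h4 h1.le)
      rw [div_le_iff₀ h0, inv_mul_eq_div, le_div_iff₀ hlt]
      refine le_of_mul_le_mul_left ?_ hV
      have h3 : variance (v k) (s k) * ((C + (j + 1 : ℕ)) / variance (v k) (s k)) =
        C + (j + 1 : ℕ) := by field_simp
      linear_combination h2 - weightSum (v k) (s k) (n k - (j + 1 : ℕ)) * h3
  induction j with
  | zero =>
    refine tendsto_const_nhds.congr' ?_
    filter_upwards [hpos 0] with k hk
    simp only [Nat.cast_zero, sub_zero] at hk ⊢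
    exact (div_self hk.ne').symm
  | succ j ih =>
    have := (hstep j).mul ih
    rw [one_mul] at this
    refine this.congr' ?_
    filter_upwards [hpos j] with k hk
    exact div_mul_div_cancel₀ hk.ne'

/-- The mean number of elements of a random subset, as a quotient of sums over all subsets. -/
lemma sum_card_mul_prod (hv : ∀ x, 0 < v x) (s : Finset ι) :
    ∑ t ∈ s.powerset, (t.card : ℝ) * ∏ x ∈ t, v x = mean v s * ∏ x ∈ s, (1 + v x) := by
  induction s using Finset.induction_on with
  | empty => simp [mean]
  | insert y s hy ih =>
    have hins : ∀ t ∈ s.powerset, ((insert y t).card : ℝ) * ∏ x ∈ insert y t, v x =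
        v y * (t.card * ∏ x ∈ t, v x) + v y * ∏ x ∈ t, v x := by
      intro t ht
      have hyt : y ∉ t := fun h => hy (Finset.mem_powerset.mp ht h)
      rw [Finset.card_insert_of_notMem hyt, Finset.prod_insert hyt]
      push_cast
      ring
    rw [Finset.sum_powerset_insert hy, Finset.sum_congr rfl hins, Finset.sum_add_distrib,
      ← Finset.mul_sum, ← Finset.mul_sum, ih, ← Finset.prod_one_add, Finset.prod_insert hy, mean,
      mean, Finset.sum_insert hy, occupation]
    have := hv y
    field_simp
    ring

end SubsetSum

noncomputable section

/-! ### Interface states as weighted sums -/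

namespace XXZ

open SubsetSum

/-- The amplitude `q^{l(x) - μ}` of a down spin at `x`. -/
def amplitude (q μ : ℝ) (x : Site) : ℝ := q ^ ((level x : ℝ) - μ)

/-- The odds `q^{2 (l(x) - μ)}` of a down spin at `x`. -/
def odds (q μ : ℝ) (x : Site) : ℝ := amplitude q μ x ^ 2

/-- The amplitude of a configuration in the grand canonical vector. -/
def configAmplitude (q μ : ℝ) {Λ : Finset Site} (α : Config Λ) : ℝ :=
  ∏ x : Λ, amplitude q μ x ^ (α x : ℕ)

lemma amplitude_pos {q : ℝ} (hq : 0 < q) (μ : ℝ) (x : Site) : 0 < amplitude q μ x :=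
  Real.rpow_pos_of_pos hq _

lemma odds_pos {q : ℝ} (hq : 0 < q) (μ : ℝ) (x : Site) : 0 < odds q μ x :=
  pow_pos (amplitude_pos hq μ x) 2

lemma odds_eq {q : ℝ} (hq : 0 < q) (μ : ℝ) (x : Site) :
    odds q μ x = q ^ (2 * ((level x : ℝ) - μ)) := by
  rw [odds, amplitude, mul_comm, Real.rpow_mul hq.le]
  norm_cast

lemma sum_config (Λ : Finset Site) (f : ℕ → ℝ) (w : Site → ℝ) :
    ∑ α : Config Λ, f (particleNumber α) * ∏ x : Λ, w x ^ (α x : ℕ) =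
      ∑ t ∈ Λ.powerset, f t.card * ∏ x ∈ t, w x := by
  classical
  have hval : ∀ s : Fin 2, (s : ℕ) = if s = 1 then 1 else 0 := by decide
  refine Finset.sum_bij'
    (fun α _ => (Finset.univ.filter fun x : Λ => α x = 1).map (Function.Embedding.subtype _))
    (fun t _ x => if x.1 ∈ t then 1 else 0) ?_ ?_ ?_ ?_ ?_
  · intro α _
    rw [Finset.mem_powerset]
    intro x hx
    simp only [Finset.mem_map, Finset.mem_filter, Finset.mem_univ, true_and] at hx
    obtain ⟨y, -, rfl⟩ := hx
    exact y.2
  · intro t _; exact Finset.mem_univ _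
  · intro α _
    funext x
    rcases Fin.exists_fin_two.mp ⟨α x, rfl⟩ with hx | hx <;> simp [hx]
  · intro t ht
    ext x
    have := Finset.mem_powerset.mp ht
    simp only [Finset.mem_map, Finset.mem_filter, Finset.mem_univ, true_and]
    constructor
    · rintro ⟨y, hy, rfl⟩
      by_contra h
      exact absurd hy (by simpa using h)
    · intro hx
      exact ⟨⟨x, this hx⟩, by simp [hx], rfl⟩
  · intro α _
    rw [Finset.card_map, Finset.prod_map, Finset.prod_filter, particleNumber, Finset.card_filter]
    simp only [hval]
    congr 1
    refine Finset.prod_congr rfl fun x _ => ?_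
    split_ifs <;> simp

lemma configAmplitude_sq (q μ : ℝ) {Λ : Finset Site} (α : Config Λ) :
    configAmplitude q μ α ^ 2 = ∏ x : Λ, odds q μ x ^ (α x : ℕ) := by
  rw [configAmplitude, ← Finset.prod_pow]
  exact Finset.prod_congr rfl fun x _ => by rw [odds, pow_right_comm]

lemma sum_configAmplitude_sq (q μ : ℝ) (Λ : Finset Site) :
    ∑ α : Config Λ, configAmplitude q μ α ^ 2 = ∏ x ∈ Λ, (1 + odds q μ x) := by
  have := sum_config Λ (fun _ => 1) (odds q μ)
  simp only [one_mul] at this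
  simp only [configAmplitude_sq, this, Finset.prod_one_add]

lemma sum_configAmplitude_sq_pos {q : ℝ} (hq : 0 < q) (μ : ℝ) (Λ : Finset Site) :
    0 < ∑ α : Config Λ, configAmplitude q μ α ^ 2 := by
  rw [sum_configAmplitude_sq]
  exact Finset.prod_pos fun x _ => by linarith [odds_pos hq μ x]

lemma sum_configAmplitude_sq_number (q μ : ℝ) (Λ : Finset Site) (m : ℤ) :
    ∑ α : Config Λ, (if (particleNumber α : ℤ) = m then configAmplitude q μ α ^ 2 else 0) =
      weightSum (odds q μ) Λ m := by
  have := sum_config Λ (fun j => if (j : ℤ) = m then 1 else 0) (odds q μ)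
  simpa only [ite_mul, one_mul, zero_mul, ← configAmplitude_sq, weightSum] using this

lemma grandCanonicalVector_eq (q μ : ℝ) {Λ : Finset Site} (α : Config Λ) :
    grandCanonicalVector q Λ μ α = (configAmplitude q μ α : ℂ) := by
  rw [grandCanonicalVector, configAmplitude, Complex.ofReal_prod]
  refine Finset.prod_congr rfl fun x _ => ?_
  rcases Fin.exists_fin_two.mp ⟨α x, rfl⟩ with hx | hx <;> simp [hx, amplitude]

/-- The expected particle number in the grand canonical state. -/
lemma grandCanonicalState_numberOperator {q : ℝ} (hq : 0 < q) (Λ : Finset Site) (μ : ℝ) :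
    grandCanonicalState q Λ μ (numberOperator Λ) = (mean (odds q μ) Λ : ℂ) := by
  have hpos := sum_configAmplitude_sq_pos hq μ Λ
  have hnum : ∑ α : Config Λ, (particleNumber α : ℝ) * configAmplitude q μ α ^ 2 =
      mean (odds q μ) Λ * ∑ α : Config Λ, configAmplitude q μ α ^ 2 := by
    rw [sum_configAmplitude_sq, ← sum_card_mul_prod (odds_pos hq μ), ← sum_config]
    simp only [configAmplitude_sq]
  rw [eq_div_of_mul_eq hpos.ne' hnum.symm, grandCanonicalState, expectation]
  push_cast
  congr 1
  · simp only [dotProduct, numberOperator, Matrix.mulVec_diagonal, Pi.star_apply,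
      grandCanonicalVector_eq, Complex.star_def, Complex.conj_ofReal]
    exact Finset.sum_congr rfl fun α _ => by ring
  · simp only [dotProduct, Pi.star_apply, grandCanonicalVector_eq, Complex.star_def,
      Complex.conj_ofReal]
    exact Finset.sum_congr rfl fun α _ => by ring

lemma configAmplitude_eq {q : ℝ} (hq : 0 < q) (μ : ℝ) {Λ : Finset Site} (α : Config Λ) :
    (∏ x : Λ, q ^ (level x * ((α x : ℕ) : ℤ)) : ℝ) =
      q ^ (μ * particleNumber α) * configAmplitude q μ α := by
  rw [particleNumber, Nat.cast_sum, Finset.mul_sum, Real.rpow_sum_of_pos hq, configAmplitude,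
    ← Finset.prod_mul_distrib]
  refine Finset.prod_congr rfl fun x _ => ?_
  rw [amplitude, ← Real.rpow_natCast, ← Real.rpow_mul hq.le, ← Real.rpow_add hq,
    ← Real.rpow_intCast]
  congr 1
  push_cast
  ring

lemma expectation_smul {Λ : Finset Site} {c : ℂ} (hc : c ≠ 0) (ψ : Config Λ → ℂ)
    (X : Observable Λ) : expectation (c • ψ) X = expectation ψ X := by
  have hc' : star c ≠ 0 := star_ne_zero.mpr hc
  unfold expectation
  rw [Matrix.mulVec_smul, star_smul]
  simp only [smul_dotProduct, dotProduct_smul, smul_eq_mul]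
  rw [← mul_assoc, ← mul_assoc, mul_div_mul_left _ _ (mul_ne_zero hc hc')]

/-- The grand canonical amplitudes restricted to `n` particles. -/
def sectorVector (q μ : ℝ) (Λ : Finset Site) (n : ℕ) : Config Λ → ℂ := fun α =>
  if particleNumber α = n then (configAmplitude q μ α : ℂ) else 0

lemma canonicalState_eq {q : ℝ} (hq : 0 < q) (μ : ℝ) (Λ : Finset Site) (n : ℕ)
    (X : Observable Λ) : canonicalState q Λ n X = expectation (sectorVector q μ Λ n) X := by
  have hc : ((q ^ (μ * n) : ℝ) : ℂ) ≠ 0 := by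
    exact_mod_cast (Real.rpow_pos_of_pos hq _).ne'
  rw [canonicalState, ← expectation_smul hc (sectorVector q μ Λ n)]
  congr 1
  funext α
  simp only [canonicalVector, sectorVector, Pi.smul_apply, smul_eq_mul, mul_ite, mul_zero]
  split_ifs with h
  · rw [configAmplitude_eq hq μ, h]
    push_cast
    rfl
  · rfl

/-- Configurations on `Λ` are pairs of configurations on `Λ₀` and on `Λ \ Λ₀`. -/
def splitConfig {Λ₀ Λ : Finset Site} (h : Λ₀ ⊆ Λ) :
    Config Λ₀ × Config (Λ \ Λ₀) ≃ Config Λ where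
  toFun p y := if hy : y.1 ∈ Λ₀ then p.1 ⟨y.1, hy⟩
    else p.2 ⟨y.1, Finset.mem_sdiff.mpr ⟨y.2, hy⟩⟩
  invFun α := (fun x => α ⟨x.1, h x.2⟩, fun y => α ⟨y.1, (Finset.mem_sdiff.mp y.2).1⟩)
  left_inv := by
    rintro ⟨a, b⟩
    refine Prod.ext ?_ ?_
    · funext x; simp
    · funext y; simp [(Finset.mem_sdiff.mp y.2).2]
  right_inv := by
    intro α; funext y
    by_cases hy : y.1 ∈ Λ₀ <;> simp [hy]

section split

variable {Λ₀ Λ : Finset Site} (h : Λ₀ ⊆ Λ)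

lemma splitConfig_left (p : Config Λ₀ × Config (Λ \ Λ₀)) (x : Λ₀) :
    splitConfig h p ⟨x.1, h x.2⟩ = p.1 x := by simp [splitConfig]

lemma splitConfig_right (p : Config Λ₀ × Config (Λ \ Λ₀)) (y : ↥(Λ \ Λ₀)) :
    splitConfig h p ⟨y.1, (Finset.mem_sdiff.mp y.2).1⟩ = p.2 y := by
  simp [splitConfig, (Finset.mem_sdiff.mp y.2).2]

@[to_additive]
lemma prod_splitConfig {M : Type*} [CommMonoid M] (F : Site → Fin 2 → M)
    (p : Config Λ₀ × Config (Λ \ Λ₀)) :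
    ∏ x : Λ, F x (splitConfig h p x) = (∏ x : Λ₀, F x (p.1 x)) * ∏ y : ↥(Λ \ Λ₀), F y (p.2 y) := by
  classical
  let G : Site → M := fun x => if hx : x ∈ Λ then F x (splitConfig h p ⟨x, hx⟩) else 1
  have h0 : ∏ x : Λ, F x (splitConfig h p x) = ∏ x ∈ Λ, G x := by
    rw [← Finset.prod_coe_sort Λ G]
    exact Finset.prod_congr rfl fun x _ => by simp [G]
  rw [h0, ← Finset.prod_sdiff h, mul_comm, ← Finset.prod_coe_sort Λ₀ G,
    ← Finset.prod_coe_sort (Λ \ Λ₀) G]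
  congr 1
  · refine Finset.prod_congr rfl fun x _ => ?_
    rw [← splitConfig_left h p x]
    simp [G, h x.2]
  · refine Finset.prod_congr rfl fun y _ => ?_
    rw [← splitConfig_right h p y]
    simp [G, (Finset.mem_sdiff.mp y.2).1]

lemma particleNumber_splitConfig (p : Config Λ₀ × Config (Λ \ Λ₀)) :
    particleNumber (splitConfig h p) = particleNumber p.1 + particleNumber p.2 :=
  sum_splitConfig h (fun _ s => (s : ℕ)) p

lemma configAmplitude_splitConfig (q μ : ℝ) (p : Config Λ₀ × Config (Λ \ Λ₀)) :
    configAmplitude q μ (splitConfig h p) = configAmplitude q μ p.1 * configAmplitude q μ p.2 :=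
  prod_splitConfig h (fun x s => amplitude q μ x ^ (s : ℕ)) p

lemma extend_splitConfig (X : Observable Λ₀) (p p' : Config Λ₀ × Config (Λ \ Λ₀)) :
    extend h X (splitConfig h p) (splitConfig h p') = if p.2 = p'.2 then X p.1 p'.1 else 0 := by
  have hagree : (∀ y : Λ, y.1 ∉ Λ₀ → splitConfig h p y = splitConfig h p' y) ↔ p.2 = p'.2 := by
    constructor
    · intro H
      funext y
      rw [← splitConfig_right h p y, ← splitConfig_right h p' y]
      exact H _ (Finset.mem_sdiff.mp y.2).2
    · intro H y hy
      have := congrFun H ⟨y.1, Finset.mem_sdiff.mpr ⟨y.2, hy⟩⟩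
      rwa [← splitConfig_right h p, ← splitConfig_right h p'] at this
  simp only [extend, Matrix.of_apply, hagree, splitConfig_left]

lemma extend_one : extend h (1 : Observable Λ₀) = 1 := by
  ext α β
  obtain ⟨p, rfl⟩ := (splitConfig h).surjective α
  obtain ⟨p', rfl⟩ := (splitConfig h).surjective β
  simp only [extend_splitConfig, Matrix.one_apply, (splitConfig h).injective.eq_iff, Prod.ext_iff]
  split_ifs <;> tauto

/-- Matrix elements between `n`-particle vectors, for local observables that conserve the particle
number. -/
lemma sectorVector_dotProduct (q μ : ℝ) (n : ℕ) {X : Observable Λ₀}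
    (hX : ∀ a a', particleNumber a ≠ particleNumber a' → X a a' = 0) :
    star (sectorVector q μ Λ n) ⬝ᵥ extend h X *ᵥ sectorVector q μ Λ n =
      ∑ a, ∑ a', X a a' * ((configAmplitude q μ a * configAmplitude q μ a' *
        weightSum (odds q μ) (Λ \ Λ₀) (n - particleNumber a) : ℝ) : ℂ) := by
  simp only [dotProduct, Matrix.mulVec, Pi.star_apply]
  rw [← Equiv.sum_comp (splitConfig h)]
  simp_rw [← Equiv.sum_comp (splitConfig h), extend_splitConfig]
  simp only [Fintype.sum_prod_type, ite_mul, zero_mul]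
  refine Finset.sum_congr rfl fun a _ => ?_
  simp only [Finset.sum_ite_eq, Finset.mem_univ, if_true, Finset.mul_sum]
  rw [Finset.sum_comm]
  refine Finset.sum_congr rfl fun a' _ => ?_
  by_cases haa : particleNumber a = particleNumber a'
  · rw [← sum_configAmplitude_sq_number, Finset.mul_sum, Complex.ofReal_sum, Finset.mul_sum]
    refine Finset.sum_congr rfl fun b _ => ?_
    have hN : (particleNumber b : ℤ) = n - particleNumber a ↔
        particleNumber a + particleNumber b = n := by omega
    simp only [sectorVector, particleNumber_splitConfig, configAmplitude_splitConfig, ← haa, hN]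
    split_ifs
    · rw [Complex.star_def, Complex.conj_ofReal]
      push_cast
      ring
    · simp
  · simp [hX a a' haa]

end split

/-- The canonical state on local observables that conserve the particle number. -/
lemma canonicalState_extend {q : ℝ} (hq : 0 < q) (μ : ℝ) {Λ₀ Λ : Finset Site} (h : Λ₀ ⊆ Λ) (n : ℕ)
    {X : Observable Λ₀} (hX : ∀ a a', particleNumber a ≠ particleNumber a' → X a a' = 0) :
    canonicalState q Λ n (extend h X) =
      (∑ a, ∑ a', X a a' * ((configAmplitude q μ a * configAmplitude q μ a' *
        weightSum (odds q μ) (Λ \ Λ₀) (n - particleNumber a) : ℝ) : ℂ)) /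
      ((∑ a : Config Λ₀, configAmplitude q μ a ^ 2 *
        weightSum (odds q μ) (Λ \ Λ₀) (n - particleNumber a) : ℝ) : ℂ) := by
  rw [canonicalState_eq hq μ, expectation, sectorVector_dotProduct h q μ n hX]
  congr 1
  have h1 := sectorVector_dotProduct h q μ n (X := 1)
    (fun a a' haa => Matrix.one_apply_ne fun hh => haa (by rw [hh]))
  rw [extend_one, Matrix.one_mulVec] at h1
  rw [h1, Complex.ofReal_sum]
  refine Finset.sum_congr rfl fun a _ => ?_
  simp only [Matrix.one_apply, ite_mul, one_mul, zero_mul, Finset.sum_ite_eq, Finset.mem_univ,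
    if_true]
  push_cast
  ring

lemma infiniteGrandCanonicalState_eq {q : ℝ} (hq : 0 < q) (μ : ℝ) {Λ₀ : Finset Site}
    (X : Observable Λ₀) :
    infiniteGrandCanonicalState q μ X =
      (∑ a, ∑ a', X a a' * ((configAmplitude q μ a * configAmplitude q μ a' : ℝ) : ℂ)) /
      ((∑ a : Config Λ₀, configAmplitude q μ a ^ 2 : ℝ) : ℂ) := by
  have hv : ∀ a : Config Λ₀, ∏ x : Λ₀, siteVector q μ x (a x) =
      ((configAmplitude q μ a / √(∏ x ∈ Λ₀, (1 + odds q μ x)) : ℝ) : ℂ) := by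
    intro a
    have hsqrt : √(∏ x ∈ Λ₀, (1 + odds q μ x)) = ∏ x : Λ₀, √(1 + odds q μ x) := by
      rw [Real.sqrt_prod _ fun x _ => by linarith [odds_pos hq μ x],
        ← Finset.prod_coe_sort Λ₀ fun x => √(1 + odds q μ x)]
    rw [hsqrt, configAmplitude, ← Finset.prod_div_distrib, Complex.ofReal_prod]
    refine Finset.prod_congr rfl fun x _ => ?_
    rcases Fin.exists_fin_two.mp ⟨a x, rfl⟩ with hx | hx <;>
      simp [hx, siteVector, odds_eq hq, amplitude]
  have hZ : 0 < ∏ x ∈ Λ₀, (1 + odds q μ x) :=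
    Finset.prod_pos fun x _ => by linarith [odds_pos hq μ x]
  rw [infiniteGrandCanonicalState, sum_configAmplitude_sq, ← Real.mul_self_sqrt hZ.le]
  simp only [hv, dotProduct, Matrix.mulVec, Pi.star_apply, Complex.star_def, Complex.conj_ofReal,
    Finset.sum_div, Finset.mul_sum]
  refine Finset.sum_congr rfl fun a _ => Finset.sum_congr rfl fun a' _ => ?_
  push_cast
  rw [mul_left_comm, div_mul_div_comm, mul_div_assoc, mul_div_assoc, mul_div_assoc]

lemma totalSpin3_eq (Λ : Finset Site) :
    totalSpin3 Λ = Matrix.diagonal fun α => (Λ.card : ℂ) / 2 - particleNumber α := by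
  ext α β
  rw [totalSpin3, Matrix.sum_apply, Matrix.diagonal_apply]
  split_ifs with hab
  · subst hab
    rw [particleNumber, ← Fintype.card_coe, ← Finset.card_univ, Finset.card_eq_sum_ones]
    push_cast
    rw [Finset.sum_div, ← Finset.sum_sub_distrib]
    refine Finset.sum_congr rfl fun x _ => ?_
    rcases Fin.exists_fin_two.mp ⟨α x, rfl⟩ with hx | hx <;> simp [siteOp, S3, hx]
    norm_num
  · refine Finset.sum_eq_zero fun x _ => ?_
    simp only [siteOp, Matrix.of_apply]
    split_ifs with hy
    · have hx : α x ≠ β x := fun hx => hab (funext fun y => by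
        by_cases hyx : y = x
        · rw [hyx, hx]
        · exact hy y hyx)
      rcases Fin.exists_fin_two.mp ⟨α x, rfl⟩ with h1 | h1 <;>
      rcases Fin.exists_fin_two.mp ⟨β x, rfl⟩ with h2 | h2 <;> simp_all [S3]
    · rfl

lemma apply_eq_zero_of_commute {Λ : Finset Site} {X : Observable Λ}
    (hX : Commute X (totalSpin3 Λ)) (a a' : Config Λ)
    (h : particleNumber a ≠ particleNumber a') : X a a' = 0 := by
  have hc := congrFun (congrFun hX.eq a) a'
  rw [totalSpin3_eq, Matrix.mul_diagonal, Matrix.diagonal_mul] at hc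
  have hne : (particleNumber a : ℂ) - particleNumber a' ≠ 0 :=
    sub_ne_zero.mpr (by exact_mod_cast h)
  have : X a a' * ((particleNumber a : ℂ) - particleNumber a') = 0 := by linear_combination hc
  exact (mul_eq_zero.mp this).resolve_right hne

end XXZ

/-! ### The thermodynamic limit -/

namespace XXZ

open SubsetSum

lemma continuous_amplitude {q : ℝ} (hq : 0 < q) (x : Site) :
    Continuous fun μ => amplitude q μ x := by
  unfold amplitude
  exact continuous_const.rpow (continuous_const.sub continuous_id) fun _ => Or.inl hq.ne'

lemma continuous_occupation {q : ℝ} (hq : 0 < q) (x : Site) :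
    Continuous fun μ => occupation (odds q μ) x := by
  have h : Continuous fun μ => odds q μ x := (continuous_amplitude hq x).pow 2
  exact h.div (continuous_const.add h) fun μ => by linarith [odds_pos hq μ x]

lemma continuous_mean {q : ℝ} (hq : 0 < q) (Λ : Finset Site) :
    Continuous fun μ => mean (odds q μ) Λ :=
  continuous_finsetSum Λ fun x _ => continuous_occupation hq x

lemma occupation_strictMono {q : ℝ} (hq0 : 0 < q) (hq1 : q < 1) (x : Site) :
    StrictMono fun μ => occupation (odds q μ) x := by
  intro μ ν h
  have h1 : odds q μ x < odds q ν x :=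
    pow_lt_pow_left₀ (Real.rpow_lt_rpow_of_exponent_gt hq0 hq1 (by linarith))
      (amplitude_pos hq0 μ x).le two_ne_zero
  have h2 := odds_pos hq0 μ x
  have h3 := odds_pos hq0 ν x
  simp only [occupation]
  rw [div_lt_div_iff₀ (by linarith) (by linarith)]
  linarith

lemma occupation_congr (q μ : ℝ) {x y : Site} (h : level x = level y) :
    occupation (odds q μ) x = occupation (odds q μ) y := by
  simp only [occupation, odds, amplitude, h]

/-- The site of the plane `l(x) = 0` with first coordinates `a` and `b`. -/
def planeSite (p : ℤ × ℤ) : Site := ![p.1, p.2, -p.1 - p.2]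

lemma level_planeSite (p : ℤ × ℤ) : level (planeSite p) = 0 := by
  simp [level, planeSite]

lemma planeSite_injective : Function.Injective planeSite := by
  intro p p' h
  have h0 := congrFun h 0
  have h1 := congrFun h 1
  simp only [planeSite, Matrix.cons_val_zero, Matrix.cons_val_one] at h0 h1
  exact Prod.ext h0 h1

lemma infinite_level_zero : {x : Site | level x = 0}.Infinite :=
  (Set.infinite_range_of_injective planeSite_injective).mono
    (Set.range_subset_iff.mpr level_planeSite)

section exhaustion

variable {S : ℕ → Finset Site} (hS : Monotone S) (hex : ∀ x, ∃ k, x ∈ S k)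

include hS hex

lemma eventually_subset (F : Finset Site) : ∀ᶠ k in atTop, F ⊆ S k := by
  choose κ hκ using hex
  filter_upwards [eventually_ge_atTop (F.sup κ)] with k hk x hx
  exact hS ((Finset.le_sup hx).trans hk) (hκ x)

/-- Every finite number of sites at level zero outside `Λ₀` is eventually contained in an
exhausting sequence of volumes. -/
lemma eventually_exists_level_zero (Λ₀ : Finset Site) (M : ℕ) :
    ∃ F : Finset Site, F.card = M ∧ (∀ x ∈ F, level x = 0) ∧ ∀ᶠ k in atTop, F ⊆ S k \ Λ₀ := by
  obtain ⟨F, hF, hM⟩ :=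
    (infinite_level_zero.sdiff Λ₀.finite_toSet).exists_subset_card_eq M
  refine ⟨F, hM, fun x hx => (hF hx).1, ?_⟩
  filter_upwards [eventually_subset hS hex F] with k hk x hx
  exact Finset.mem_sdiff.mpr ⟨hk hx, (hF hx).2⟩

lemma tendsto_variance {q : ℝ} (hq : 0 < q) {μs : ℕ → ℝ} {μ : ℝ} (hμ : Tendsto μs atTop (𝓝 μ))
    (Λ₀ : Finset Site) :
    Tendsto (fun k => variance (odds q (μs k)) (S k \ Λ₀)) atTop atTop := by
  set g : ℝ → ℝ := fun ν => occupation (odds q ν) 0 * (1 - occupation (odds q ν) 0) with hg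
  have hgc : Continuous g :=
    (continuous_occupation hq 0).mul (continuous_const.sub (continuous_occupation hq 0))
  have hpos : ∀ ν x, 0 < occupation (odds q ν) x * (1 - occupation (odds q ν) x) := fun ν x =>
    mul_pos (occupation_pos (odds_pos hq ν) x)
      (sub_pos.mpr (occupation_lt_one (odds_pos hq ν) x))
  have hc : 0 < g μ := hpos μ 0
  rw [tendsto_atTop]
  intro b
  obtain ⟨M, hM⟩ := exists_nat_gt (b / (g μ / 2))
  obtain ⟨F, hFM, hF0, hFS⟩ := eventually_exists_level_zero hS hex Λ₀ M
  have hev := ((hgc.tendsto μ).comp hμ).eventually_const_lt (half_lt_self hc)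
  filter_upwards [hFS, hev] with k hk hk'
  calc b ≤ M * (g μ / 2) := ((div_lt_iff₀ (half_pos hc)).mp hM).le
    _ ≤ M * g (μs k) := mul_le_mul_of_nonneg_left (le_of_lt hk') M.cast_nonneg
    _ = variance (odds q (μs k)) F := by
      rw [variance, Finset.sum_congr rfl (g := fun _ => g (μs k)), Finset.sum_const, hFM,
        nsmul_eq_mul]
      intro x hx
      rw [hg, occupation_congr q _ ((hF0 x hx).trans (by simp [level]) : level x = level 0)]
    _ ≤ _ := Finset.sum_le_sum_of_subset_of_nonneg hk fun x _ _ => (hpos _ x).le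

/-- Equivalence of the canonical and the grand canonical ensembles. -/
theorem convergesToGrandCanonical {q : ℝ} (hq : 0 < q) {n : ℕ → ℕ} {μs : ℕ → ℝ} {μ : ℝ}
    (hn : ∀ k, mean (odds q (μs k)) (S k) = n k) (hμ : Tendsto μs atTop (𝓝 μ)) :
    ConvergesToGrandCanonical q S (fun k => canonicalState q (S k) (n k)) μ := by
  intro Λ₀ X hX ε hε
  have hX0 := apply_eq_zero_of_commute hX
  set W : ℕ → ℤ → ℝ := fun k m => weightSum (odds q (μs k)) (S k \ Λ₀) m with hW
  have hvar := tendsto_variance hS hex hq hμ Λ₀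
  have hclose : ∀ᶠ k in atTop,
      |((n k : ℤ) : ℝ) - mean (odds q (μs k)) (S k \ Λ₀)| ≤ Λ₀.card := by
    filter_upwards [eventually_subset hS hex Λ₀] with k hk
    have : ((n k : ℤ) : ℝ) - mean (odds q (μs k)) (S k \ Λ₀) = mean (odds q (μs k)) Λ₀ := by
      rw [Int.cast_natCast, ← hn k, mean, ← Finset.sum_sdiff hk, mean, mean]
      ring
    have hv := odds_pos hq (μs k)
    rw [this, mean, abs_of_nonneg (Finset.sum_nonneg fun x _ => (occupation_pos hv x).le),
      Finset.card_eq_sum_ones, Nat.cast_sum]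
    exact Finset.sum_le_sum fun x _ => by simpa using (occupation_lt_one hv x).le
  have hratio := tendsto_weightSum_div (fun k => odds_pos hq (μs k)) hclose hvar
  have hamp : ∀ a : Config Λ₀, Tendsto (fun k => configAmplitude q (μs k) a) atTop
      (𝓝 (configAmplitude q μ a)) := fun a =>
    tendsto_finsetProd _ fun x _ => (((continuous_amplitude hq x.1).tendsto μ).comp hμ).pow _
  have hnum : Tendsto (fun k => ∑ a, ∑ a', X a a' *
      ((configAmplitude q (μs k) a * configAmplitude q (μs k) a' *
        (W k (n k - (particleNumber a : ℕ)) / W k (n k)) : ℝ) : ℂ)) atTop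
      (𝓝 (∑ a, ∑ a', X a a' *
        ((configAmplitude q μ a * configAmplitude q μ a' * 1 : ℝ) : ℂ))) :=
    tendsto_finsetSum _ fun a _ => tendsto_finsetSum _ fun a' _ =>
      tendsto_const_nhds.mul ((Complex.continuous_ofReal.tendsto _).comp
        (((hamp a).mul (hamp a')).mul (hratio (particleNumber a))))
  have hden : Tendsto (fun k => ((∑ a : Config Λ₀, configAmplitude q (μs k) a ^ 2 *
        (W k (n k - (particleNumber a : ℕ)) / W k (n k)) : ℝ) : ℂ)) atTop
      (𝓝 ((∑ a : Config Λ₀, configAmplitude q μ a ^ 2 * 1 : ℝ) : ℂ)) :=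
    (Complex.continuous_ofReal.tendsto _).comp (tendsto_finsetSum _ fun a _ =>
      ((hamp a).pow 2).mul (hratio (particleNumber a)))
  simp only [mul_one] at hnum hden
  have hlim := hnum.div hden
    (by exact_mod_cast (sum_configAmplitude_sq_pos hq μ Λ₀).ne')
  rw [← infiniteGrandCanonicalState_eq hq] at hlim
  have hWpos : ∀ᶠ k in atTop, W k (n k) ≠ 0 := by
    filter_upwards [(hratio 0).eventually_ne one_ne_zero] with k hk h0
    exact hk (by rw [show weightSum (odds q (μs k)) (S k \ Λ₀) (n k) = 0 from h0, div_zero])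
  obtain ⟨K, hK⟩ := eventually_atTop.mp (((eventually_subset hS hex Λ₀).and hWpos).and
    (Metric.tendsto_nhds.mp hlim ε hε))
  refine ⟨K, fun k hk => ?_⟩
  obtain ⟨⟨h, hWk⟩, hd⟩ := hK k hk
  refine ⟨h, ?_⟩
  rw [dist_eq_norm] at hd
  have hWk' : (W k (n k) : ℂ) ≠ 0 := by exact_mod_cast hWk
  refine lt_of_eq_of_lt (congrArg (fun z => ‖z - infiniteGrandCanonicalState q μ X‖) ?_) hd
  refine (canonicalState_extend hq (μs k) h (n k) hX0).trans ?_
  rw [← div_div_div_cancel_right₀ hWk', Pi.div_apply]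
  congr 1
  · simp only [Finset.sum_div]
    refine Finset.sum_congr rfl fun a _ => Finset.sum_congr rfl fun a' _ => ?_
    push_cast
    ring
  · rw [← Complex.ofReal_div, Finset.sum_div]
    simp only [hW, mul_div_assoc]

/-- For large volumes, some chemical potential close to `μ` gives an integer mean particle
number. -/
lemma eventually_exists_mean_eq {q : ℝ} (hq0 : 0 < q) (hq1 : q < 1) (μ : ℝ) {δ : ℝ} (hδ : 0 < δ) :
    ∀ᶠ k in atTop, ∃ ν ∈ Set.Icc μ (μ + δ), ∃ n : ℕ, mean (odds q ν) (S k) = n := by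
  set g : ℝ → ℝ := fun ν => occupation (odds q ν) 0 with hg
  have hc : 0 < g (μ + δ) - g μ :=
    sub_pos.mpr (occupation_strictMono hq0 hq1 0 (lt_add_of_pos_right μ hδ))
  obtain ⟨M, hM⟩ := exists_nat_gt (1 / (g (μ + δ) - g μ))
  obtain ⟨F, hFM, hF0, hFS⟩ := eventually_exists_level_zero hS hex ∅ M
  filter_upwards [hFS] with k hk
  rw [Finset.sdiff_empty] at hk
  have hgap : mean (odds q μ) (S k) + 1 ≤ mean (odds q (μ + δ)) (S k) := by
    rw [← le_sub_iff_add_le', mean, mean, ← Finset.sum_sub_distrib]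
    calc 1 ≤ M * (g (μ + δ) - g μ) := ((div_lt_iff₀ hc).mp hM).le
      _ = ∑ x ∈ F, (occupation (odds q (μ + δ)) x - occupation (odds q μ) x) := by
        rw [Finset.sum_congr rfl (g := fun _ => g (μ + δ) - g μ), Finset.sum_const, hFM,
          nsmul_eq_mul]
        intro x hx
        have hl : level x = level 0 := (hF0 x hx).trans (by simp [level])
        rw [hg, occupation_congr q _ hl, occupation_congr q _ hl]
      _ ≤ _ := Finset.sum_le_sum_of_subset_of_nonneg hk fun x _ _ =>
        sub_nonneg.mpr ((occupation_strictMono hq0 hq1 x).monotone (by linarith))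
  have h0 : 0 ≤ mean (odds q μ) (S k) :=
    Finset.sum_nonneg fun x _ => (occupation_pos (odds_pos hq0 μ) x).le
  obtain ⟨ν, hν, h⟩ := intermediate_value_Icc (le_add_of_nonneg_right hδ.le)
    (continuous_mean hq0 (S k)).continuousOn
    (show (⌈mean (odds q μ) (S k)⌉₊ : ℝ) ∈ Set.Icc _ _ from
      ⟨Nat.le_ceil _, (Nat.ceil_lt_add_one h0).le.trans hgap⟩)
  exact ⟨ν, hν, _, h⟩

end exhaustion

/-- The cylinder of length `2 k` whose base consists of the sites of the plane `l(x) = 0` with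
first two coordinates in `[-k, k]`. -/
def squareCylinder (k : ℕ) : CylindricalVolume where
  base := (Finset.Icc (-k : ℤ) k ×ˢ Finset.Icc (-k : ℤ) k).image planeSite
  level_base x hx := by
    obtain ⟨p, -, rfl⟩ := Finset.mem_image.mp hx
    exact level_planeSite p
  length := 2 * k
  even_length := even_two_mul k

lemma mem_squareCylinder {k : ℕ} {x : Site} : x ∈ (squareCylinder k).sites ↔
    |level x| ≤ k ∧ |x 0 - stickSite (level x) 0| ≤ k ∧ |x 1 - stickSite (level x) 1| ≤ k := by
  simp only [CylindricalVolume.sites, squareCylinder, Finset.mem_image₂, finiteStick,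
    Finset.mem_image, Finset.mem_product, Finset.mem_Icc, Nat.mul_div_cancel_left k two_pos,
    abs_le]
  constructor
  · rintro ⟨_, ⟨p, hp, rfl⟩, _, ⟨l, hl, rfl⟩, rfl⟩
    have hlev : level (planeSite p + stickSite l) = l := by
      have h1 := level_planeSite p
      have h2 := level_stickSite l
      simp only [level, Pi.add_apply] at h1 h2 ⊢
      linarith
    rw [hlev]
    simpa [planeSite] using And.intro hl hp
  · rintro ⟨hl, h0, h1⟩
    refine ⟨planeSite (x 0 - stickSite (level x) 0, x 1 - stickSite (level x) 1),
      ⟨_, ⟨h0, h1⟩, rfl⟩, _, ⟨level x, hl, rfl⟩, ?_⟩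
    have h2 := level_stickSite (level x)
    ext i
    fin_cases i
    · simp [planeSite]
    · simp [planeSite]
    · simp only [planeSite, Fin.reduceFinMk, Pi.add_apply, Matrix.cons_val]
      have h3 : level x = x 0 + x 1 + x 2 := rfl
      have h4 : level (stickSite (level x)) = stickSite (level x) 0 + stickSite (level x) 1 +
        stickSite (level x) 2 := rfl
      linarith

lemma squareCylinder_isThermodynamicSequence {φ : ℕ → ℕ} (hφ : StrictMono φ) :
    IsThermodynamicSequence fun k => squareCylinder (φ k) where
  monotone := by
    intro j k hjk x hx
    have : (φ j : ℤ) ≤ φ k := by exact_mod_cast hφ.monotone hjk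
    rw [mem_squareCylinder] at hx ⊢
    exact ⟨hx.1.trans this, hx.2.1.trans this, hx.2.2.trans this⟩
  exhausts x := by
    set m := max |level x| (max |x 0 - stickSite (level x) 0| |x 1 - stickSite (level x) 1|)
      with hm
    have hk : m ≤ φ m.toNat :=
      (Int.self_le_toNat m).trans (by exact_mod_cast hφ.le_apply)
    refine ⟨m.toNat, mem_squareCylinder.mpr ⟨?_, ?_, ?_⟩⟩
    · exact (le_max_left _ _).trans hk
    · exact ((le_max_left _ _).trans (le_max_right _ _)).trans hk
    · exact ((le_max_right _ _).trans (le_max_right _ _)).trans hk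
  growth := by
    refine IsBigO.of_bound 1 (Eventually.of_forall fun k => ?_)
    have hcard : (squareCylinder (φ k)).base.card = (2 * φ k + 1) ^ 2 := by
      rw [squareCylinder, Finset.card_image_of_injective _ planeSite_injective,
        Finset.card_product, Int.card_Icc, sq,
        show ((φ k : ℤ) + 1 - -(φ k : ℤ)).toNat = 2 * φ k + 1 by omega]
    rw [CylindricalVolume.linearSize, hcard, Nat.cast_pow, Real.sqrt_sq (Nat.cast_nonneg _),
      one_mul, Real.norm_natCast, Real.norm_natCast]
    exact_mod_cast Nat.le_succ _

end XXZ

end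

theorem mainTheorem3 (q : ℝ) (hq0 : 0 < q) (hq1 : q < 1) :
    (∀ (V : ℕ → XXZ.CylindricalVolume) (n : ℕ → ℕ) (μs : ℕ → ℝ) (μ : ℝ),
      XXZ.IsThermodynamicSequence V →
      (∀ k, XXZ.grandCanonicalState q (V k).sites (μs k)
        (XXZ.numberOperator (V k).sites) = (n k : ℂ)) →
      Tendsto μs atTop (𝓝 μ) →
      XXZ.ConvergesToGrandCanonical q (fun k => (V k).sites)
        (fun k => XXZ.canonicalState q (V k).sites (n k)) μ) ∧
    (∀ μ : ℝ, ∃ (V : ℕ → XXZ.CylindricalVolume) (n : ℕ → ℕ) (μs : ℕ → ℝ),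
      XXZ.IsThermodynamicSequence V ∧
      (∀ k, XXZ.grandCanonicalState q (V k).sites (μs k)
        (XXZ.numberOperator (V k).sites) = (n k : ℂ)) ∧
      Tendsto μs atTop (𝓝 μ) ∧
      XXZ.ConvergesToGrandCanonical q (fun k => (V k).sites)
        (fun k => XXZ.canonicalState q (V k).sites (n k)) μ) := by
  constructor
  · intro V n μs μ hV hn hμ
    refine XXZ.convergesToGrandCanonical hV.monotone hV.exhausts hq0 (fun k => ?_) hμ
    have := hn k
    rw [XXZ.grandCanonicalState_numberOperator hq0] at this
    exact_mod_cast this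
  · intro μ
    have hW := XXZ.squareCylinder_isThermodynamicSequence strictMono_id
    obtain ⟨φ, hφ, h⟩ := extraction_forall_of_eventually fun j : ℕ =>
      XXZ.eventually_exists_mean_eq hW.monotone hW.exhausts hq0 hq1 μ
        (Nat.one_div_pos_of_nat (α := ℝ) (n := j))
    choose μs hμs n hn using h
    have hV := XXZ.squareCylinder_isThermodynamicSequence hφ
    have hμ : Tendsto μs atTop (𝓝 μ) := by
      refine tendsto_of_tendsto_of_tendsto_of_le_of_le tendsto_const_nhds ?_
        (fun j => (hμs j).1) (fun j => (hμs j).2)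
      simpa using tendsto_const_nhds.add (tendsto_one_div_add_atTop_nhds_zero_nat (𝕜 := ℝ))
    refine ⟨_, n, μs, hV, fun k => ?_, hμ,
      XXZ.convergesToGrandCanonical hV.monotone hV.exhausts hq0 hn hμ⟩
    rw [XXZ.grandCanonicalState_numberOperator hq0]
    exact_mod_cast hn k
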